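/- Let $M\subset\mathbb C^N$ be a compact, smooth, embedded CR-manifold of hypersurface type: a compact smooth submanifold of real dimension $2n-1$, $n\ge 1$, such that $T^{1,0}_x(M)=T^{1,0}_x(\mathbb C^N)\cap(T_xM\otimes\mathbb C)$ has complex dimension $n-1$ for every $x\in M$. Put $T^{0,1}(M)=\overline{T^{1,0}(M)}$, and use the Hermitian metric for which $\partial/\partial z_1,\dots,\partial/\partial z_N$ are orthonormal. Suppose that $M$ is weakly pseudoconvex, and let $\gamma$ be a smooth, purely imaginary, nowhere vanishing global one-form on $M$ that annihilates $T^{1,0}(M)\oplus T^{0,1}(M)$ and whose Levi form is positive semi-definite, that is, $\langle d\gamma_x, L\wedge\bar L\rangle\ge 0$ for all $x\in M$, $L\in T^{1,0}_x(M)$. For a smooth function $\lambda$ near $M$, let $\partial_b\lambda$ (respectively $\bar\partial_b\lambda$) be the one-form on $M$ that equals $d\lambda$ on $T^{1,0}(M)$ (respectively $T^{0,1}(M)$) and vanishes on $T^{0,1}(M)$ (respectively $T^{1,0}(M)$) and on the direction in $TM$ orthogonal to $T^{1,0}(M)\oplus T^{0,1}(M)$. The forms $\partial_b\bar\partial_b\lambda$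 and $\bar\partial_b\partial_b\lambda$ are the $(1,1)$-parts of $d(\bar\partial_b\lambda)$ and $d(\partial_b\lambda)$. Let $q\ge 0$ be an integer, let $A_\lambda\ge 0$, and let $\lambda$ be a smooth real-valued function on an open neighborhood $U$ of $M$ that is plurisubharmonic on $(0,q)$-forms on $U$ with constant $A_\lambda$: at every point of $U$, the sum of any $q$ eigenvalues (counted with multiplicity) of the complex Hessian $\big(\partial^2\lambda/\partial z_j\partial\bar z_k\big)_{j,k=1}^N$ is at least $A_\lambda$. Then $\lambda$ is CR-plurisubharmonic on $(0,q)$-forms on $M$ with the same constant $A_\lambda$: there is a constant $A_0>0$ such that for every $x\in M$ and all orthonormal $Z_1,\dots,Z_q\in T^{1,0}_x(M)$, $$\sum_{j=1}^q\Big\langle \tfrac12\big(\partial_b\bar\partial_b\lambda-\bar\partial_b\partial_b\lambda\big)+A_0\,d\gamma,\; Z_j\wedge\bar Z_j\Big\rangle\ \ge\ A_\lambda .$$ (So $\lambda$ is weakly CR-plurisubharmonic on $(0,q)$-forms, and strictly so if $A_\lambda>0$.) -/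

import Mathlib

open Set Filter Topology
open scoped ContDiff

noncomputable section

namespace CRGeom

/-- Complex Euclidean space `ℂ^N` with its usual Hermitian inner product. -/
abbrev Cn (N : ℕ) : Type := EuclideanSpace ℂ (Fin N)

variable {N : ℕ}

/-- Multiplication by `i` on `ℂ^N` as a real-linear map (the complex structure `J`). -/
def J (N : ℕ) : Cn N →L[ℝ] Cn N :=
  (Complex.I • ContinuousLinearMap.id ℂ (Cn N)).restrictScalars ℝ

/-- `J v = i v`. -/
theorem J_apply (v : Cn N) : J N v = Complex.I • v := rfl

/-! ### The operators `∂` and `∂̄` on functions and the complex Hessian -/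

/-- `∂ f` at `x`, as a complex-valued real-linear form on real vectors:
`∂f(v) = (df(v) - i df(Jv)) / 2`.  In particular `∂f(e_j) = ∂f/∂z_j`. -/
def del (f : Cn N → ℂ) (x : Cn N) : Cn N →L[ℝ] ℂ :=
  (1 / 2 : ℂ) • (fderiv ℝ f x - Complex.I • (fderiv ℝ f x ∘L J N))

/-- `∂̄ f` at `x`: `∂̄f(v) = (df(v) + i df(Jv)) / 2`.
In particular `∂̄f(e_k) = ∂f/∂z̄_k`. -/
def delbar (f : Cn N → ℂ) (x : Cn N) : Cn N →L[ℝ] ℂ :=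
  (1 / 2 : ℂ) • (fderiv ℝ f x + Complex.I • (fderiv ℝ f x ∘L J N))

/-- The complex Hessian `(∂²f/∂z_j∂z̄_k)_{j,k}` at `x`. -/
def complexHessian (f : Cn N → ℂ) (x : Cn N) : Matrix (Fin N) (Fin N) ℂ :=
  fun j k => del (fun y => delbar f y (EuclideanSpace.single k 1)) x (EuclideanSpace.single j 1)

/-- `lam` is plurisubharmonic on `(0,q)`-forms on `U`, with plurisubharmonicity constant `A`:
`lam` is smooth on `U`, `A ≥ 0`, and at every point of `U` the sum of any `q` eigenvalues
(counted with multiplicity) of the complex Hessian is at least `A`.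
(The complex Hessian of a smooth real function on an open set is automatically Hermitian;
the witness only gives access to its real eigenvalues.) -/
def IsPshOnForms (q : ℕ) (lam : Cn N → ℝ) (U : Set (Cn N)) (A : ℝ) : Prop :=
  ContDiffOn ℝ ∞ lam U ∧ 0 ≤ A ∧
    ∀ x ∈ U, ∃ h : (complexHessian (fun y => (lam y : ℂ)) x).IsHermitian,
      ∀ s : Finset (Fin N), s.card = q → A ≤ ∑ i ∈ s, h.eigenvalues i

/-! ### Submanifolds of `ℂ^N` and the induced CR structure -/

/-- `M` is a smooth embedded submanifold of `ℂ^N` of real dimension `d`: locally it is the zero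
set of a smooth map to `ℝ^k`, `k = 2N - d`, with surjective differential. -/
def IsSmoothSubmanifold (M : Set (Cn N)) (d : ℕ) : Prop :=
  ∃ k : ℕ, d + k = 2 * N ∧
    ∀ x ∈ M, ∃ U : Set (Cn N), IsOpen U ∧ x ∈ U ∧
      ∃ ρ : Cn N → EuclideanSpace ℝ (Fin k), ContDiffOn ℝ ∞ ρ U ∧
        (∀ y ∈ U, Function.Surjective (fderiv ℝ ρ y)) ∧
        M ∩ U = {y ∈ U | ρ y = 0}

/-- The real tangent space `T_x M ⊆ ℂ^N`.  For a smooth submanifold the tangent cone is already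
a linear subspace (the kernel of the differential of a local defining map). -/
def tangentSp (M : Set (Cn N)) (x : Cn N) : Submodule ℝ (Cn N) :=
  Submodule.span ℝ (tangentConeAt ℝ M x)

/-- The space `T^{1,0}_x(M) = T^{1,0}_x(ℂ^N) ∩ (T_x M ⊗ ℂ)`, where `ξ ∈ ℂ^N` stands for the vector
`Z_ξ = ∑ ξ_j ∂/∂z_j = (ξ - i Jξ) / 2`.  This vector lies in `T_x M ⊗ ℂ` iff both `ξ` and `Jξ` lie in
`T_x M`.  The identification `ξ ↦ Z_ξ` is complex-linear and it is isometric for the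
Hermitian inner product in which the `∂/∂z_j` are orthonormal. -/
def T10 (M : Set (Cn N)) (x : Cn N) : Submodule ℂ (Cn N) where
  carrier := {ξ | ξ ∈ tangentSp M x ∧ Complex.I • ξ ∈ tangentSp M x}
  add_mem' := by
    rintro a b ⟨ha, ha'⟩ ⟨hb, hb'⟩
    refine ⟨add_mem ha hb, ?_⟩
    rw [smul_add]
    exact add_mem ha' hb'
  zero_mem' := by simp
  smul_mem' := by
    rintro c ξ ⟨h, h'⟩
    have key : ∀ (a b : ℝ), a • ξ + b • (Complex.I • ξ) ∈ tangentSp M x := fun a b =>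
      add_mem (Submodule.smul_mem _ a h) (Submodule.smul_mem _ b h')
    constructor
    · have e : c • ξ = c.re • ξ + c.im • (Complex.I • ξ) := by
        ext i
        simp only [PiLp.smul_apply, PiLp.add_apply, smul_eq_mul, Complex.real_smul]
        conv_lhs => rw [← Complex.re_add_im c]
        ring
      rw [e]
      exact key _ _
    · have e : Complex.I • c • ξ = (-c.im) • ξ + c.re • (Complex.I • ξ) := by
        ext i
        simp only [PiLp.smul_apply, PiLp.add_apply, smul_eq_mul, Complex.real_smul]
        conv_lhs => rw [← Complex.re_add_im c]
        push_cast
        linear_combination (c.im : ℂ) * ξ i * Complex.I_sq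
      rw [e]
      exact key _ _

/-- `M ⊆ ℂ^N` is a smooth CR-manifold of hypersurface type of real dimension `2n - 1`, with the
induced CR structure: `dim_ℂ T^{1,0}_x(M) = n - 1` at every point. -/
def IsCRHypersurfaceType (M : Set (Cn N)) (n : ℕ) : Prop :=
  1 ≤ n ∧ IsSmoothSubmanifold M (2 * n - 1) ∧
    ∀ x ∈ M, Module.finrank ℂ (T10 M x) = n - 1

/-! ### Forms along `M` -/

/-- Complex-valued one-forms along `M`: a form `α` is represented by real-linear functionals
`α x` on `ℂ^N`, of which only the restrictions to `T_x M`, `x ∈ M`, matter.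
Its exterior derivative on `M` is `dα(u,v) = (D_u α)(v) - (D_v α)(u)` for `u, v ∈ T_x M`, where the
derivative is taken along `M`. -/
def extD (M : Set (Cn N)) (α : Cn N → Cn N →L[ℝ] ℂ) (x u v : Cn N) : ℂ :=
  fderivWithin ℝ α M x u v - fderivWithin ℝ α M x v u

/-- The value `⟨Ω, Z_ξ ∧ conj Z_ζ⟩` of (the complex bilinear extension of) a two-form `Ω` on
`Z_ξ = (ξ - i Jξ)/2` and `conj Z_ζ = (ζ + i Jζ)/2`. -/
def pair11 (Ω : Cn N → Cn N → ℂ) (ξ ζ : Cn N) : ℂ :=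
  (1 / 4 : ℂ) * (Ω ξ ζ + Complex.I * Ω ξ (J N ζ) - Complex.I * Ω (J N ξ) ζ
    + Ω (J N ξ) (J N ζ))

/-- The component of type `(1,0) + (0,1)` of a real tangent vector: orthogonal projection onto the
maximal complex subspace of `T_x M` (i.e. along the orthogonal direction `T`).  If `h` is the
image of `v`, the `(1,0)` and `(0,1)` components of `v` are `(h - i Jh)/2` and `(h + i Jh)/2`. -/
def projH (M : Set (Cn N)) (x : Cn N) : Cn N →L[ℝ] Cn N :=
  ((T10 M x).starProjection).restrictScalars ℝ

/-- `∂_b f`: the one-form on `M` equal to `df` on `T^{1,0}(M)` and zero on `T^{0,1}(M)` and on the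
direction `T` orthogonal to `T^{1,0}(M) ⊕ T^{0,1}(M)`. -/
def delb (M : Set (Cn N)) (f : Cn N → ℂ) (x : Cn N) : Cn N →L[ℝ] ℂ :=
  del f x ∘L projH M x

/-- `∂̄_b f`: the one-form on `M` equal to `df` on `T^{0,1}(M)` and zero on `T^{1,0}(M)` and on the
direction `T`. -/
def delbarb (M : Set (Cn N)) (f : Cn N → ℂ) (x : Cn N) : Cn N →L[ℝ] ℂ :=
  delbar f x ∘L projH M x

/-- `⟨∂_b ∂̄_b f, Z_ξ ∧ conj Z_ζ⟩` at `x`: `∂_b` of a `(0,1)`-form is the `(1,1)`-part of its exterior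
derivative on `M`. -/
def delbDelbarb (M : Set (Cn N)) (f : Cn N → ℂ) (x ξ ζ : Cn N) : ℂ :=
  pair11 (extD M (delbarb M f) x) ξ ζ

/-- `⟨∂̄_b ∂_b f, Z_ξ ∧ conj Z_ζ⟩` at `x`: `∂̄_b` of a `(1,0)`-form is the `(1,1)`-part of its exterior
derivative on `M`. -/
def delbarbDelb (M : Set (Cn N)) (f : Cn N → ℂ) (x ξ ζ : Cn N) : ℂ :=
  pair11 (extD M (delb M f) x) ξ ζ

/-- `γ` is a smooth, purely imaginary, global one-form on `M` which annihilates
`T^{1,0}(M) ⊕ T^{0,1}(M)` and satisfies `γ(T) = -1` for a purely imaginary tangent vector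
`T = i t`, `t ∈ T_x M`, at every point (equivalently, `γ` vanishes nowhere). -/
structure IsCharacteristicForm (M : Set (Cn N)) (γ : Cn N → Cn N →L[ℝ] ℂ) : Prop where
  smooth : ContDiffOn ℝ ∞ γ M
  imaginary : ∀ x ∈ M, ∀ v ∈ tangentSp M x, (γ x v).re = 0
  annihilates : ∀ x ∈ M, ∀ v ∈ T10 M x, γ x v = 0
  normalized : ∀ x ∈ M, ∃ t ∈ tangentSp M x, Complex.I * γ x t = -1

/-- The Levi form `⟨dγ_x, Z_ξ ∧ conj Z_ζ⟩`. -/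
def leviForm (M : Set (Cn N)) (γ : Cn N → Cn N →L[ℝ] ℂ) (x ξ ζ : Cn N) : ℂ :=
  pair11 (extD M γ x) ξ ζ

/-- The Levi form given by `γ` is positive semi-definite at every point of `M`; `M` is weakly
pseudoconvex when this holds for some characteristic form `γ`. -/
def LeviNonneg (M : Set (Cn N)) (γ : Cn N → Cn N →L[ℝ] ℂ) : Prop :=
  ∀ x ∈ M, ∀ ξ ∈ T10 M x, 0 ≤ (leviForm M γ x ξ ξ).re

/-! ### CR-plurisubharmonicity -/

/-- There is `A₀ > 0` such that at every `x ∈ M` and for all orthonormal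
`Z_1, …, Z_q ∈ T^{1,0}_x(M)`,
`∑_j ⟨(∂_b ∂̄_b lam - ∂̄_b ∂_b lam)/2 + A₀ dγ, Z_j ∧ conj Z_j⟩ ≥ A`
(the left side is real). -/
def CRPshBound (M : Set (Cn N)) (γ : Cn N → Cn N →L[ℝ] ℂ) (q : ℕ) (lam : Cn N → ℝ)
    (A : ℝ) : Prop :=
  ∃ A₀ : ℝ, 0 < A₀ ∧ ∀ x ∈ M, ∀ Z : Fin q → Cn N, (∀ j, Z j ∈ T10 M x) → Orthonormal ℂ Z →
    A ≤ (∑ j, ((1 / 2 : ℂ) * (delbDelbarb M (fun y => (lam y : ℂ)) x (Z j) (Z j)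
        - delbarbDelb M (fun y => (lam y : ℂ)) x (Z j) (Z j))
      + (A₀ : ℂ) * leviForm M γ x (Z j) (Z j))).re

/-- `lam` is smooth on some open neighbourhood of `M`. -/
def SmoothNear (M : Set (Cn N)) (lam : Cn N → ℝ) : Prop :=
  ∃ U : Set (Cn N), IsOpen U ∧ M ⊆ U ∧ ContDiffOn ℝ ∞ lam U

/-- `lam` is weakly CR-plurisubharmonic on `(0,q)`-forms with constant `A ≥ 0`. -/
def IsWeaklyCRPsh (M : Set (Cn N)) (γ : Cn N → Cn N →L[ℝ] ℂ) (q : ℕ) (lam : Cn N → ℝ)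
    (A : ℝ) : Prop :=
  SmoothNear M lam ∧ 0 ≤ A ∧ CRPshBound M γ q lam A

/-- `lam` is strictly CR-plurisubharmonic on `(0,q)`-forms with constant `A > 0`. -/
def IsStrictlyCRPsh (M : Set (Cn N)) (γ : Cn N → Cn N →L[ℝ] ℂ) (q : ℕ) (lam : Cn N → ℝ)
    (A : ℝ) : Prop :=
  SmoothNear M lam ∧ 0 < A ∧ CRPshBound M γ q lam A

end CRGeom

end

/-!
Write `P` for the orthogonal projection `projH` onto the maximal complex subspaces of the tangent
spaces of `M`. For `u, v ∈ T^{1,0}` the product rule gives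
`d(α ∘ P)(u, v) = dα(u, v) + α([Pu, Pv])`, where the bracket is tangent to `M` and orthogonal to
`T^{1,0}`, hence a multiple of the transverse vector `t` with `γ(t) = i`. Taking `α = γ` expresses
the multiple by the Levi form, so that `d(α ∘ P) = dα + i α(t) dγ` on `T^{1,0}`. With `α = ∂̄λ`
and `α = ∂λ` this says that `½(∂_b ∂̄_b - ∂̄_b ∂_b)λ` is the complex Hessian of `λ` minus
`½ dλ(Jt)` times the Levi form. By compactness `½ dλ(Jt)` is bounded on `M`, and any positive
upper bound serves as `A₀` because the Levi form is nonnegative; the sum of the Hessian over `q`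
orthonormal vectors is then at least `A` by Ky Fan's minimum principle.
-/

noncomputable section

namespace CRGeom

section KyFan

theorem exists_card_eq_forall_le_le {ι α : Type*} [Fintype ι] [LinearOrder α] [Nonempty α]
    (l : ι → α) {q : ℕ} (hq : q ≤ Fintype.card ι) :
    ∃ s : Finset ι, s.card = q ∧ ∃ μ, (∀ i ∈ s, l i ≤ μ) ∧ ∀ i ∉ s, μ ≤ l i := by
  classical
  induction q with
  | zero =>
    obtain ⟨μ, hμ⟩ := (Set.finite_range l).bddBelow
    exact ⟨∅, rfl, μ, by simp, fun i _ => hμ ⟨i, rfl⟩⟩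
  | succ q ih =>
    obtain ⟨s, hcard, μ, hle, hge⟩ := ih (Nat.le_of_succ_le hq)
    have hcompl : sᶜ.Nonempty := by
      rw [← Finset.card_pos, Finset.card_compl]
      omega
    obtain ⟨i, hi, hmin⟩ := sᶜ.exists_min_image l hcompl
    rw [Finset.mem_compl] at hi
    refine ⟨insert i s, by rw [Finset.card_insert_of_notMem hi, hcard], l i, ?_, ?_⟩
    · intro j hj
      rcases Finset.mem_insert.1 hj with rfl | hj
      exacts [le_rfl, (hle j hj).trans (hge i hi)]
    · intro j hj
      exact hmin j (Finset.mem_compl.2 fun h => hj (Finset.mem_insert_of_mem h))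

theorem le_sum_mul_of_forall_card_eq_le_sum {ι R : Type*} [Fintype ι] [CommRing R] [LinearOrder R]
    [IsStrictOrderedRing R] {l c : ι → R} {q : ℕ} {A : R}
    (hA : ∀ s : Finset ι, s.card = q → A ≤ ∑ i ∈ s, l i)
    (h0 : ∀ i, 0 ≤ c i) (h1 : ∀ i, c i ≤ 1) (hc : ∑ i, c i = q) :
    A ≤ ∑ i, l i * c i := by
  classical
  have hq : q ≤ Fintype.card ι := by
    have h : ∑ i, c i ≤ Fintype.card ι • (1 : R) := Finset.sum_le_card_nsmul _ _ _ fun i _ => h1 i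
    rw [hc, nsmul_one] at h
    exact_mod_cast h
  obtain ⟨s, hcard, μ, hle, hge⟩ := exists_card_eq_forall_le_le l hq
  -- `μ` separates `s` from its complement, so moving weight from `s` elsewhere raises the sum.
  have hterm (i : ι) : (if i ∈ s then l i else 0) + μ * (c i - if i ∈ s then 1 else 0)
      ≤ l i * c i := by
    split_ifs with hi
    · nlinarith [mul_nonneg (sub_nonneg.2 (hle i hi)) (sub_nonneg.2 (h1 i))]
    · nlinarith [mul_le_mul_of_nonneg_right (hge i hi) (h0 i)]
  calc A ≤ ∑ i ∈ s, l i := hA s hcard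
    _ = ∑ i, ((if i ∈ s then l i else 0) + μ * (c i - if i ∈ s then 1 else 0)) := by
      simp [Finset.sum_add_distrib, ← Finset.mul_sum, Finset.sum_sub_distrib, hc, hcard]
    _ ≤ ∑ i, l i * c i := Finset.sum_le_sum fun i _ => hterm i

variable {𝕜 E ι : Type*} [RCLike 𝕜] [NormedAddCommGroup E] [InnerProductSpace 𝕜 E] [Fintype ι]

theorem re_inner_map_self_eq_sum_of_apply_eq_smul (b : OrthonormalBasis ι 𝕜 E) {T : E →ₗ[𝕜] E}
    {l : ι → ℝ} (hT : ∀ i, T (b i) = (l i : 𝕜) • b i) (w : E) :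
    RCLike.re (inner 𝕜 w (T w)) = ∑ i, l i * ‖inner 𝕜 (b i) w‖ ^ 2 := by
  have hTw : T w = ∑ i, (inner 𝕜 (b i) w * l i : 𝕜) • b i := by
    conv_lhs => rw [← b.sum_repr' w, map_sum]
    exact Finset.sum_congr rfl fun i _ => by rw [map_smul, hT, smul_smul]
  rw [hTw, inner_sum, map_sum]
  refine Finset.sum_congr rfl fun i _ => ?_
  rw [inner_smul_right, mul_right_comm, ← inner_conj_symm w, RCLike.mul_conj, mul_comm]
  norm_cast

theorem le_sum_re_inner_map_self_of_forall_card_eq_le_sum {κ : Type*} [Fintype κ]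
    (b : OrthonormalBasis ι 𝕜 E) {T : E →ₗ[𝕜] E} {l : ι → ℝ}
    (hT : ∀ i, T (b i) = (l i : 𝕜) • b i) {A : ℝ}
    (hA : ∀ s : Finset ι, s.card = Fintype.card κ → A ≤ ∑ i ∈ s, l i)
    {w : κ → E} (hw : Orthonormal 𝕜 w) :
    A ≤ ∑ j, RCLike.re (inner 𝕜 (w j) (T (w j))) := by
  have hle_one (i : ι) : ∑ j, ‖inner 𝕜 (b i) (w j)‖ ^ 2 ≤ 1 := by
    simpa only [norm_inner_symm, b.norm_eq_one, one_pow] using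
      hw.sum_inner_products_le (s := Finset.univ) (b i)
  have htotal : ∑ i, ∑ j, ‖inner 𝕜 (b i) (w j)‖ ^ 2 = (Fintype.card κ : ℝ) := by
    rw [Finset.sum_comm]
    simp [b.sum_sq_norm_inner_right, hw.norm_eq_one]
  calc A ≤ ∑ i, l i * ∑ j, ‖inner 𝕜 (b i) (w j)‖ ^ 2 :=
        le_sum_mul_of_forall_card_eq_le_sum hA (fun i => by positivity) hle_one htotal
    _ = ∑ j, RCLike.re (inner 𝕜 (w j) (T (w j))) := by
      simp_rw [re_inner_map_self_eq_sum_of_apply_eq_smul b hT, Finset.mul_sum]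
      exact Finset.sum_comm

theorem le_sum_re_inner_toEuclideanLin {κ : Type*} [DecidableEq ι] [Fintype κ]
    {H : Matrix ι ι 𝕜} (hH : H.IsHermitian) {A : ℝ}
    (hA : ∀ s : Finset ι, s.card = Fintype.card κ → A ≤ ∑ i ∈ s, hH.eigenvalues i)
    {w : κ → EuclideanSpace 𝕜 ι} (hw : Orthonormal 𝕜 w) :
    A ≤ ∑ j, RCLike.re (inner 𝕜 (w j) (Matrix.toEuclideanLin H (w j))) := by
  refine le_sum_re_inner_map_self_of_forall_card_eq_le_sum hH.eigenvectorBasis (fun i => ?_) hA hw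
  ext k
  simpa [Matrix.toLpLin_apply, Algebra.smul_def] using
    congrFun (hH.mulVec_eigenvectorBasis i) k

end KyFan

section KernelProjection

open ContinuousLinearMap (adjoint)

section Surjective

variable {𝕜 E F : Type*} [RCLike 𝕜] [NormedAddCommGroup E] [InnerProductSpace 𝕜 E]
  [CompleteSpace E] [NormedAddCommGroup F] [InnerProductSpace 𝕜 F] [FiniteDimensional 𝕜 F]
  [CompleteSpace F]

theorem isUnit_comp_adjoint_iff_surjective {K : E →L[𝕜] F} :
    IsUnit (K ∘L adjoint K) ↔ Function.Surjective K := by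
  rw [ContinuousLinearMap.isUnit_iff_bijective]
  refine ⟨fun h y => (h.2 y).imp' (adjoint K) fun _ hx => hx, fun hK => ?_⟩
  have hadj : (adjoint K).ker = ⊥ := by
    rw [← K.orthogonal_range, LinearMap.range_eq_top.2 hK, Submodule.top_orthogonal_eq_bot]
  have hinj : Function.Injective (K ∘L adjoint K) :=
    LinearMap.ker_eq_bot.1 (K.ker_self_comp_adjoint.trans hadj)
  exact ⟨hinj, LinearMap.surjective_of_injective (f := (K ∘L adjoint K).toLinearMap) hinj⟩

theorem starProjection_ker_eq_of_surjective {K : E →L[𝕜] F} (hK : Function.Surjective K) :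
    K.ker.starProjection = ContinuousLinearMap.id 𝕜 E -
      adjoint K ∘L Ring.inverse (K ∘L adjoint K) ∘L K := by
  have hKK := Ring.mul_inverse_cancel _ (isUnit_comp_adjoint_iff_surjective.2 hK)
  ext v
  refine Submodule.eq_starProjection_of_mem_of_inner_eq_zero ?_ fun w hw => ?_
  · have hv : K (adjoint K (Ring.inverse (K ∘L adjoint K) (K v))) = K v :=
      DFunLike.congr_fun hKK (K v)
    simp [LinearMap.mem_ker, hv]
  · have hw : K w = 0 := hw
    simp [ContinuousLinearMap.adjoint_inner_left, hw]

theorem eventually_surjective_of_continuousWithinAt {X : Type*} [TopologicalSpace X] {s : Set X}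
    {x : X} {K : X → E →L[𝕜] F} (hK : ContinuousWithinAt K s x)
    (hsurj : Function.Surjective (K x)) : ∀ᶠ y in 𝓝[s] x, Function.Surjective (K y) := by
  have hKK : ContinuousWithinAt (fun y => K y ∘L adjoint (K y)) s x :=
    hK.clm_comp ((LinearIsometryEquiv.continuous adjoint).continuousAt.comp_continuousWithinAt hK)
  have hunit := isUnit_comp_adjoint_iff_surjective.2 hsurj
  filter_upwards [hKK.eventually hunit.unit.nhds] with y hy
  exact isUnit_comp_adjoint_iff_surjective.1 hy

end Surjective

variable {E : Type*} [NormedAddCommGroup E] [InnerProductSpace ℝ E]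

section InnerTarget

variable [CompleteSpace E] {F : Type*} [NormedAddCommGroup F] [InnerProductSpace ℝ F]
  [CompleteSpace F]

theorem isBoundedLinearMap_adjoint : IsBoundedLinearMap ℝ fun K : E →L[ℝ] F => adjoint K where
  map_add := map_add _
  map_smul c K := by simp
  bound := ⟨1, one_pos, fun K => by simp⟩

variable [FiniteDimensional ℝ F]

theorem differentiableWithinAt_starProjection_ker_of_surjective {X : Type*}
    [NormedAddCommGroup X] [NormedSpace ℝ X] {s : Set X} {x : X} {K : X → E →L[ℝ] F}
    (hK : DifferentiableWithinAt ℝ K s x) (hsurj : Function.Surjective (K x)) :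
    DifferentiableWithinAt ℝ (fun y => (K y).ker.starProjection) s x := by
  have hadj : DifferentiableWithinAt ℝ (fun y => adjoint (K y)) s x :=
    isBoundedLinearMap_adjoint.differentiableAt.comp_differentiableWithinAt x hK
  have hinv := DifferentiableWithinAt.inverse (R := F →L[ℝ] F) (hK.clm_comp hadj)
    (isUnit_comp_adjoint_iff_surjective.2 hsurj)
  have hformula := (differentiableWithinAt_const (ContinuousLinearMap.id ℝ E)).sub
    (hadj.clm_comp (hinv.clm_comp hK))
  refine hformula.congr_of_eventuallyEq ?_ (starProjection_ker_eq_of_surjective hsurj)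
  filter_upwards [eventually_surjective_of_continuousWithinAt hK.continuousWithinAt hsurj]
    with y hy
  exact starProjection_ker_eq_of_surjective hy

end InnerTarget

theorem differentiableWithinAt_starProjection_ker_of_finrank_eq [FiniteDimensional ℝ E]
    {F X : Type*} [NormedAddCommGroup F] [NormedSpace ℝ F] [FiniteDimensional ℝ F]
    [NormedAddCommGroup X] [NormedSpace ℝ X] {s : Set X} {x : X} {K : X → E →L[ℝ] F}
    (hK : DifferentiableWithinAt ℝ K s x)
    (hrank : ∀ᶠ y in 𝓝[s] x, Module.finrank ℝ (K y).ker = Module.finrank ℝ (K x).ker) :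
    DifferentiableWithinAt ℝ (fun y => (K y).ker.starProjection) s x := by
  have hinj : ((K x).toLinearMap ∘ₗ (K x).kerᗮ.subtype).ker = ⊥ := by
    rw [LinearMap.ker_comp, ← Submodule.disjoint_iff_comap_eq_bot]
    exact (K x).ker.isOrtho_orthogonal_right.disjoint.symm
  obtain ⟨R, hR⟩ := LinearMap.exists_leftInverse_of_injective _ hinj
  set L : X → E →L[ℝ] (K x).kerᗮ := fun y => R.toContinuousLinearMap ∘L K y
  have hLsurj : Function.Surjective (L x) := fun w => ⟨w, DFunLike.congr_fun hR w⟩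
  have hLdiff : DifferentiableWithinAt ℝ L s x := (differentiableWithinAt_const _).clm_comp hK
  have hker {y : X} (hy : Function.Surjective (L y))
      (hfin : Module.finrank ℝ (K y).ker = Module.finrank ℝ (K x).ker) :
      (K y).ker = (L y).ker := by
    refine Submodule.eq_of_le_of_finrank_le ?_ ?_
    · exact LinearMap.ker_le_ker_comp (K y).toLinearMap R
    · have hrange := (L y).toLinearMap.finrank_range_add_finrank_ker
      rw [LinearMap.range_eq_top.2 hy, finrank_top] at hrange
      have horth := (K x).ker.finrank_add_finrank_orthogonal
      omega
  refine (differentiableWithinAt_starProjection_ker_of_surjective hLdiff hLsurj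
    ).congr_of_eventuallyEq ?_ ?_
  · filter_upwards [hrank, eventually_surjective_of_continuousWithinAt hLdiff.continuousWithinAt
      hLsurj] with y hfin hy
    simp only [hker hy hfin]
  · simp only [hker hLsurj rfl]

end KernelProjection

variable {N : ℕ}

theorem differentiableAt_fderiv_of_contDiffAt {𝕜 E F : Type*} [NontriviallyNormedField 𝕜]
    [NormedAddCommGroup E] [NormedSpace 𝕜 E] [NormedAddCommGroup F] [NormedSpace 𝕜 F] {f : E → F}
    {x : E} {n : ℕ∞ω} (hf : ContDiffAt 𝕜 n f x) (hn : 2 ≤ n) :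
    DifferentiableAt 𝕜 (fderiv 𝕜 f) x :=
  (hf.fderiv_right (m := 1) (one_add_one_eq_two.trans_le hn)).differentiableAt one_ne_zero

theorem tangentConeAt_levelSet_eq_ker {𝕜 E F : Type*} [NontriviallyNormedField 𝕜] [CompleteSpace 𝕜]
    [NormedAddCommGroup E] [NormedSpace 𝕜 E] [CompleteSpace E] [NormedAddCommGroup F]
    [NormedSpace 𝕜 F] [FiniteDimensional 𝕜 F] {f : E → F} {f' : E →L[𝕜] F} {a : E}
    (hf : HasStrictFDerivAt f f' a) (hf' : f'.range = ⊤) :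
    tangentConeAt 𝕜 {y | f y = f a} a = f'.ker := by
  refine Subset.antisymm (fun v hv => ?_) fun v hv => ?_
  · have hconst : HasFDerivWithinAt f (0 : E →L[𝕜] F) {y | f y = f a} a :=
      (hasFDerivWithinAt_const (f a) a _).congr (fun y hy => hy) rfl
    exact hf.hasFDerivAt.hasFDerivWithinAt.unique_on hconst hv
  · set g : f'.ker → E := hf.implicitFunction f f' hf' (f a)
    have hg0 : g 0 = a := hf.implicitFunction_apply_image hf'
    have hmem : ∀ᶠ w in 𝓝 (0 : f'.ker), f (g w) = f a :=
      (Continuous.prodMk_right (f a)).continuousAt.eventually (hf.map_implicitFunction_eq hf')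
    have hg : HasFDerivWithinAt g f'.ker.subtypeL {w | f (g w) = f a} 0 :=
      (hf.to_implicitFunction hf').hasFDerivAt.hasFDerivWithinAt
    have hv' : (⟨v, hv⟩ : f'.ker) ∈ tangentConeAt 𝕜 {w | f (g w) = f a} 0 := by
      rw [tangentConeAt_of_mem_nhds hmem]
      exact mem_univ _
    have hcone := hg.mapsTo_tangent_cone hv'
    rw [hg0] at hcone
    exact tangentConeAt_mono (image_subset_iff.2 fun w hw => hw) hcone

theorem eqOn_tangentSp_of_hasFDerivWithinAt {F : Type*} [NormedAddCommGroup F] [NormedSpace ℝ F]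
    {M : Set (Cn N)} {x : Cn N} {g : Cn N → F} {g₁ g₂ : Cn N →L[ℝ] F}
    (h₁ : HasFDerivWithinAt g g₁ M x) (h₂ : HasFDerivWithinAt g g₂ M x) :
    EqOn g₁ g₂ (tangentSp M x) :=
  LinearMap.eqOn_span' (f := g₁.toLinearMap) (g := g₂.toLinearMap) (h₁.unique_on h₂)

theorem IsSmoothSubmanifold.exists_eventually_tangentSp_eq_ker {M : Set (Cn N)} {d : ℕ}
    (hM : IsSmoothSubmanifold M d) {x : Cn N} (hx : x ∈ M) :
    ∃ (k : ℕ) (ρ : Cn N → EuclideanSpace ℝ (Fin k)), d + k = 2 * N ∧ ContDiffAt ℝ ∞ ρ x ∧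
      ∀ᶠ y in 𝓝[M] x, Function.Surjective (fderiv ℝ ρ y) ∧
        tangentSp M y = (fderiv ℝ ρ y).ker := by
  obtain ⟨k, hk, hloc⟩ := hM
  obtain ⟨U, hU, hxU, ρ, hρ, hsurj, hMU⟩ := hloc x hx
  refine ⟨k, ρ, hk, hρ.contDiffAt (hU.mem_nhds hxU), ?_⟩
  filter_upwards [self_mem_nhdsWithin, mem_nhdsWithin_of_mem_nhds (hU.mem_nhds hxU)] with y hy hyU
  have hρy : ρ y = 0 := (hMU.subset ⟨hy, hyU⟩).2
  have hnhds : 𝓝[M] y = 𝓝[{z | ρ z = ρ y}] y := by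
    refine nhdsWithin_eq_nhdsWithin hyU hU ?_
    rw [hMU, hρy]
    exact inter_comm _ _
  have hstrict : HasStrictFDerivAt ρ (fderiv ℝ ρ y) y :=
    (hρ.contDiffAt (hU.mem_nhds hyU)).hasStrictFDerivAt (by simp)
  refine ⟨hsurj y hyU, ?_⟩
  rw [tangentSp, tangentConeAt_congr hnhds,
    tangentConeAt_levelSet_eq_ker hstrict (LinearMap.range_eq_top.2 (hsurj y hyU)),
    Submodule.span_eq]

theorem IsSmoothSubmanifold.finrank_tangentSp {M : Set (Cn N)} {d : ℕ}
    (hM : IsSmoothSubmanifold M d) {x : Cn N} (hx : x ∈ M) :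
    Module.finrank ℝ (tangentSp M x) = d := by
  obtain ⟨k, ρ, hk, -, hloc⟩ := hM.exists_eventually_tangentSp_eq_ker hx
  obtain ⟨hsurj, htan⟩ := hloc.self_of_nhdsWithin hx
  have hrank := (fderiv ℝ ρ x).toLinearMap.finrank_range_add_finrank_ker
  rw [← htan, LinearMap.range_eq_top.2 hsurj, finrank_top, finrank_real_of_complex,
    finrank_euclideanSpace_fin, finrank_euclideanSpace_fin] at hrank
  omega

theorem T10_restrictScalars_eq_ker {M : Set (Cn N)} {y : Cn N} {F : Type*} [NormedAddCommGroup F]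
    [NormedSpace ℝ F] {L : Cn N →L[ℝ] F} (hL : tangentSp M y = L.ker) :
    (T10 M y).restrictScalars ℝ = (L.prod (L ∘L J N)).ker := by
  ext v
  change v ∈ tangentSp M y ∧ Complex.I • v ∈ tangentSp M y ↔ (L v, L (J N v)) = 0
  rw [hL, Prod.mk_eq_zero]
  rfl

theorem projH_eq_starProjection_restrictScalars (M : Set (Cn N)) (y : Cn N) :
    projH M y = ((T10 M y).restrictScalars ℝ).starProjection := by
  ext1 v
  symm
  refine Submodule.eq_starProjection_of_mem_of_inner_eq_zero
    (Submodule.starProjection_apply_mem (T10 M y) v) fun w hw => ?_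
  have horth := Submodule.starProjection_inner_eq_zero (K := T10 M y) v w hw
  have hre (a b : Cn N) : inner ℝ a b = (inner ℂ a b).re := by
    simp [PiLp.inner_apply]
  rw [hre]
  exact congrArg Complex.re horth

theorem IsCRHypersurfaceType.finrank_T10_restrictScalars {M : Set (Cn N)} {n : ℕ}
    (hM : IsCRHypersurfaceType M n) {x : Cn N} (hx : x ∈ M) :
    Module.finrank ℝ ((T10 M x).restrictScalars ℝ) = 2 * (n - 1) := by
  rw [← hM.2.2 x hx]
  exact finrank_real_of_complex (T10 M x)

theorem IsCRHypersurfaceType.differentiableOn_projH {M : Set (Cn N)} {n : ℕ}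
    (hM : IsCRHypersurfaceType M n) : DifferentiableOn ℝ (projH M) M := by
  intro x hx
  obtain ⟨k, ρ, -, hρ, hloc⟩ := hM.2.1.exists_eventually_tangentSp_eq_ker hx
  set K : Cn N → Cn N →L[ℝ] EuclideanSpace ℝ (Fin k) × EuclideanSpace ℝ (Fin k) :=
    fun y => (fderiv ℝ ρ y).prod (fderiv ℝ ρ y ∘L J N)
  have hfderiv : DifferentiableWithinAt ℝ (fderiv ℝ ρ) M x :=
    (differentiableAt_fderiv_of_contDiffAt hρ (by norm_cast)).differentiableWithinAt
  have hK : DifferentiableWithinAt ℝ K M x :=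
    (ContinuousLinearMap.prodₗᵢ (𝕜 := ℝ) (E := Cn N) (F := EuclideanSpace ℝ (Fin k))
      (G := EuclideanSpace ℝ (Fin k)) ℝ).differentiableAt.comp_differentiableWithinAt x
      (hfderiv.prodMk (hfderiv.clm_comp (differentiableWithinAt_const (J N))))
  have hker : ∀ᶠ y in 𝓝[M] x, y ∈ M ∧ (T10 M y).restrictScalars ℝ = (K y).ker := by
    filter_upwards [self_mem_nhdsWithin, hloc] with y hy hloc_y
    exact ⟨hy, T10_restrictScalars_eq_ker hloc_y.2⟩
  have hproj : projH M =ᶠ[𝓝[M] x] fun y => (K y).ker.starProjection := by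
    filter_upwards [hker] with y hy
    simp only [projH_eq_starProjection_restrictScalars, hy.2]
  have hrank : ∀ᶠ y in 𝓝[M] x, Module.finrank ℝ (K y).ker = Module.finrank ℝ (K x).ker := by
    filter_upwards [hker] with y hy
    rw [← hy.2, ← (hker.self_of_nhdsWithin hx).2, hM.finrank_T10_restrictScalars hy.1,
      hM.finrank_T10_restrictScalars hx]
  exact (differentiableWithinAt_starProjection_ker_of_finrank_eq hK hrank).congr_of_eventuallyEq
    hproj (hproj.self_of_nhdsWithin hx)

theorem isClosed_setOf_mem_tangentSp {M : Set (Cn N)} {d : ℕ} (hM : IsSmoothSubmanifold M d)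
    (hclosed : IsClosed M) : IsClosed {p : Cn N × Cn N | p.1 ∈ M ∧ p.2 ∈ tangentSp M p.1} := by
  set S := {p : Cn N × Cn N | p.1 ∈ M ∧ p.2 ∈ tangentSp M p.1}
  refine isClosed_of_closure_subset fun p hp => ?_
  have hpM : p.1 ∈ M :=
    hclosed.closure_eq ▸ map_mem_closure continuous_fst hp fun q hq => hq.1
  obtain ⟨k, ρ, -, hρ, hloc⟩ := hM.exists_eventually_tangentSp_eq_ker hpM
  have hcont : ContinuousAt (fun q : Cn N × Cn N => fderiv ℝ ρ q.1 q.2) p :=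
    (ContinuousAt.comp (f := Prod.fst) (hρ.continuousAt_fderiv (by simp))
      continuousAt_fst).clm_apply continuousAt_snd
  have hfst : Tendsto Prod.fst (𝓝[S] p) (𝓝[M] p.1) :=
    continuous_fst.continuousWithinAt.tendsto_nhdsWithin fun q hq => hq.1
  have hzero : (fun q : Cn N × Cn N => fderiv ℝ ρ q.1 q.2) =ᶠ[𝓝[S] p] fun _ => 0 := by
    filter_upwards [self_mem_nhdsWithin, hfst.eventually hloc] with q hqS hq
    exact hq.2.le hqS.2
  have : (𝓝[S] p).NeBot := mem_closure_iff_nhdsWithin_neBot.1 hp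
  refine ⟨hpM, ?_⟩
  rw [(hloc.self_of_nhdsWithin hpM).2]
  exact tendsto_nhds_unique_of_eventuallyEq hcont.continuousWithinAt tendsto_const_nhds hzero

theorem exists_smul_eq_of_projH_eq_zero {M : Set (Cn N)} {n : ℕ} (hM : IsCRHypersurfaceType M n)
    {x : Cn N} (hx : x ∈ M) {t w : Cn N} (ht : t ∈ tangentSp M x) (htP : projH M x t = 0)
    (ht0 : t ≠ 0) (hw : w ∈ tangentSp M x) (hwP : projH M x w = 0) : ∃ c : ℝ, c • t = w := by
  set H := (T10 M x).restrictScalars ℝ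
  have hmem {v : Cn N} (hv : v ∈ tangentSp M x) (hvP : projH M x v = 0) :
      v ∈ Hᗮ ⊓ tangentSp M x := by
    rw [projH_eq_starProjection_restrictScalars] at hvP
    exact ⟨(Submodule.starProjection_apply_eq_zero_iff _).1 hvP, hv⟩
  have hrank : Module.finrank ℝ ↥(Hᗮ ⊓ tangentSp M x) = 1 := by
    refine Submodule.finrank_add_inf_finrank_orthogonal'
      (show H ≤ tangentSp M x from fun v hv => hv.1) ?_
    rw [hM.finrank_T10_restrictScalars hx, hM.2.1.finrank_tangentSp hx]
    have hn := hM.1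
    omega
  have ht0' : (⟨t, hmem ht htP⟩ : ↥(Hᗮ ⊓ tangentSp M x)) ≠ 0 :=
    fun h => ht0 (congrArg Subtype.val h)
  obtain ⟨c, hc⟩ := (finrank_eq_one_iff_of_nonzero' _ ht0').1 hrank ⟨w, hmem hw hwP⟩
  exact ⟨c, congrArg Subtype.val hc⟩

theorem J_mem_T10 {M : Set (Cn N)} {x ξ : Cn N} (hξ : ξ ∈ T10 M x) : J N ξ ∈ T10 M x :=
  (T10 M x).smul_mem Complex.I hξ

theorem projH_mem_T10 (M : Set (Cn N)) (x v : Cn N) : projH M x v ∈ T10 M x :=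
  Submodule.starProjection_apply_mem _ v

theorem projH_eq_self {M : Set (Cn N)} {x v : Cn N} (hv : v ∈ T10 M x) : projH M x v = v :=
  (Submodule.starProjection_eq_self_iff (K := T10 M x)).2 hv

theorem projH_comp_projH (M : Set (Cn N)) (x : Cn N) : projH M x ∘L projH M x = projH M x := by
  ext1 v
  exact projH_eq_self (projH_mem_T10 M x v)

section HorizontalBracket

variable {M : Set (Cn N)} {x : Cn N}

theorem fderivWithin_comp_projH_apply {F : Type*} [NormedAddCommGroup F] [NormedSpace ℝ F]
    (hP : DifferentiableWithinAt ℝ (projH M) M x) {α : Cn N → Cn N →L[ℝ] F}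
    (hα : DifferentiableWithinAt ℝ α M x) {u v : Cn N} (hu : u ∈ tangentSp M x)
    (hv : v ∈ T10 M x) :
    fderivWithin ℝ (fun y => α y ∘L projH M y) M x u v
      = fderivWithin ℝ α M x u v + α x (fderivWithin ℝ (projH M) M x u v) := by
  have h := hα.hasFDerivWithinAt.clm_comp hP.hasFDerivWithinAt
  rw [eqOn_tangentSp_of_hasFDerivWithinAt h.differentiableWithinAt.hasFDerivWithinAt h hu]
  simp [projH_eq_self hv, add_comm]

theorem projH_fderivWithin_projH (hP : DifferentiableWithinAt ℝ (projH M) M x) {u v : Cn N}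
    (hu : u ∈ tangentSp M x) (hv : v ∈ T10 M x) :
    projH M x (fderivWithin ℝ (projH M) M x u v) = 0 := by
  have h := fderivWithin_comp_projH_apply hP hP hu hv
  simpa only [projH_comp_projH, left_eq_add] using h

theorem fderivWithin_apply_of_eventually_forall_T10_eq_zero {F : Type*} [NormedAddCommGroup F]
    [NormedSpace ℝ F] (hx : x ∈ M) (hP : DifferentiableWithinAt ℝ (projH M) M x)
    {α : Cn N → Cn N →L[ℝ] F} (hα : DifferentiableWithinAt ℝ α M x)
    (h0 : ∀ᶠ y in 𝓝[M] x, ∀ v ∈ T10 M y, α y v = 0) {u v : Cn N}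
    (hu : u ∈ tangentSp M x) (hv : v ∈ T10 M x) :
    fderivWithin ℝ α M x u v = -α x (fderivWithin ℝ (projH M) M x u v) := by
  have hcomp : (fun y => α y ∘L projH M y) =ᶠ[𝓝[M] x] fun _ => 0 := by
    filter_upwards [h0] with y hy
    ext w
    exact hy _ (projH_mem_T10 M y w)
  have h := fderivWithin_comp_projH_apply hP hα hu hv
  rw [hcomp.fderivWithin_eq (hcomp.self_of_nhdsWithin hx), fderivWithin_const_apply] at h
  exact eq_neg_of_add_eq_zero_left h.symm

/-- The value at `x` of the Lie bracket of the sections `y ↦ projH M y u` and `y ↦ projH M y v` of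
the complex tangent bundle, for `u, v ∈ T10 M x`; its transverse component is the Levi form. -/
def horizontalBracket (M : Set (Cn N)) (x u v : Cn N) : Cn N :=
  fderivWithin ℝ (projH M) M x u v - fderivWithin ℝ (projH M) M x v u

theorem projH_horizontalBracket (hP : DifferentiableWithinAt ℝ (projH M) M x) {u v : Cn N}
    (hu : u ∈ T10 M x) (hv : v ∈ T10 M x) : projH M x (horizontalBracket M x u v) = 0 := by
  rw [horizontalBracket, map_sub, projH_fderivWithin_projH hP hu.1 hv,
    projH_fderivWithin_projH hP hv.1 hu, sub_zero]

theorem horizontalBracket_mem_tangentSp {d : ℕ} (hM : IsSmoothSubmanifold M d) (hx : x ∈ M)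
    (hP : DifferentiableWithinAt ℝ (projH M) M x) {u v : Cn N}
    (hu : u ∈ T10 M x) (hv : v ∈ T10 M x) : horizontalBracket M x u v ∈ tangentSp M x := by
  obtain ⟨k, ρ, -, hρ, hloc⟩ := hM.exists_eventually_tangentSp_eq_ker hx
  have hd : DifferentiableAt ℝ (fderiv ℝ ρ) x :=
    differentiableAt_fderiv_of_contDiffAt hρ (by norm_cast)
  have hsymm : IsSymmSndFDerivAt ℝ ρ x := hρ.isSymmSndFDerivAt (by simpa using ENat.LEInfty.out)
  have hann : ∀ᶠ y in 𝓝[M] x, ∀ w ∈ T10 M y, fderiv ℝ ρ y w = 0 := by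
    filter_upwards [hloc] with y hy w hw
    exact hy.2.le hw.1
  -- Since `dρ ∘ P` vanishes along `M`, the bracket measures the asymmetry of `D²ρ`, which is zero.
  have hsecond {a b : Cn N} (ha : a ∈ T10 M x) (hb : b ∈ T10 M x) :
      fderiv ℝ (fderiv ℝ ρ) x a b = -fderiv ℝ ρ x (fderivWithin ℝ (projH M) M x a b) := by
    rw [← fderivWithin_apply_of_eventually_forall_T10_eq_zero hx hP hd.differentiableWithinAt hann
      ha.1 hb, eqOn_tangentSp_of_hasFDerivWithinAt hd.differentiableWithinAt.hasFDerivWithinAt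
        hd.hasFDerivAt.hasFDerivWithinAt ha.1]
  have hzero : fderiv ℝ ρ x (horizontalBracket M x u v) = 0 := by
    have h := hsymm.eq u v
    rw [hsecond hu hv, hsecond hv hu, neg_inj] at h
    rw [horizontalBracket, map_sub, h, sub_self]
  rw [(hloc.self_of_nhdsWithin hx).2]
  exact hzero

theorem extD_comp_projH (hP : DifferentiableWithinAt ℝ (projH M) M x)
    {α : Cn N → Cn N →L[ℝ] ℂ} (hα : DifferentiableWithinAt ℝ α M x) {u v : Cn N}
    (hu : u ∈ T10 M x) (hv : v ∈ T10 M x) :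
    extD M (fun y => α y ∘L projH M y) x u v
      = extD M α x u v + α x (horizontalBracket M x u v) := by
  rw [extD, extD, horizontalBracket, fderivWithin_comp_projH_apply hP hα hu.1 hv,
    fderivWithin_comp_projH_apply hP hα hv.1 hu, map_sub]
  ring

theorem extD_eq_neg_apply_horizontalBracket (hx : x ∈ M)
    (hP : DifferentiableWithinAt ℝ (projH M) M x) {α : Cn N → Cn N →L[ℝ] ℂ}
    (hα : DifferentiableWithinAt ℝ α M x) (h0 : ∀ᶠ y in 𝓝[M] x, ∀ v ∈ T10 M y, α y v = 0)
    {u v : Cn N} (hu : u ∈ T10 M x) (hv : v ∈ T10 M x) :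
    extD M α x u v = -α x (horizontalBracket M x u v) := by
  rw [extD, horizontalBracket,
    fderivWithin_apply_of_eventually_forall_T10_eq_zero hx hP hα h0 hu.1 hv,
    fderivWithin_apply_of_eventually_forall_T10_eq_zero hx hP hα h0 hv.1 hu, map_sub]
  ring

end HorizontalBracket

/-- `t` is the tangent vector of `M` at `x` which is orthogonal to the maximal complex subspace of
`T_x M` and normalized by `γ(t) = i`; it gives the transverse direction `T = i t` of the paper. -/
structure IsCharacteristicVector (M : Set (Cn N)) (γ : Cn N → Cn N →L[ℝ] ℂ) (x t : Cn N) :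
    Prop where
  mem_tangentSp : t ∈ tangentSp M x
  projH_eq_zero : projH M x t = 0
  apply_eq_I : γ x t = Complex.I

section CharacteristicVector

variable {M : Set (Cn N)} {n : ℕ} {γ : Cn N → Cn N →L[ℝ] ℂ} {x t : Cn N}

theorem IsCharacteristicVector.ne_zero (ht : IsCharacteristicVector M γ x t) : t ≠ 0 := by
  rintro rfl
  exact Complex.I_ne_zero (ht.apply_eq_I.symm.trans (map_zero _))

theorem IsCharacteristicForm.exists_isCharacteristicVector (hγ : IsCharacteristicForm M γ)
    (hx : x ∈ M) : ∃ t, IsCharacteristicVector M γ x t := by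
  obtain ⟨t, ht, hγt⟩ := hγ.normalized x hx
  have hPt := projH_mem_T10 M x t
  refine ⟨t - projH M x t, sub_mem ht hPt.1, ?_, ?_⟩
  · rw [map_sub, projH_eq_self hPt, sub_self]
  · rw [map_sub, hγ.annihilates x hx _ hPt, sub_zero]
    linear_combination -Complex.I * hγt + γ x t * Complex.I_sq

theorem IsCharacteristicVector.exists_smul_eq (ht : IsCharacteristicVector M γ x t)
    (hM : IsCRHypersurfaceType M n) (hx : x ∈ M) {w : Cn N} (hw : w ∈ tangentSp M x)
    (hPw : projH M x w = 0) : ∃ c : ℝ, c • t = w :=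
  exists_smul_eq_of_projH_eq_zero hM hx ht.mem_tangentSp ht.projH_eq_zero ht.ne_zero hw hPw

theorem IsCharacteristicVector.extD_comp_projH (ht : IsCharacteristicVector M γ x t)
    (hM : IsCRHypersurfaceType M n) (hγ : IsCharacteristicForm M γ) (hx : x ∈ M)
    {α : Cn N → Cn N →L[ℝ] ℂ} (hα : DifferentiableWithinAt ℝ α M x) {u v : Cn N}
    (hu : u ∈ T10 M x) (hv : v ∈ T10 M x) :
    extD M (fun y => α y ∘L projH M y) x u v
      = extD M α x u v + Complex.I * α x t * extD M γ x u v := by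
  have hP := hM.differentiableOn_projH x hx
  obtain ⟨c, hc⟩ := ht.exists_smul_eq hM hx (horizontalBracket_mem_tangentSp hM.2.1 hx hP hu hv)
    (projH_horizontalBracket hP hu hv)
  have hann : ∀ᶠ y in 𝓝[M] x, ∀ w ∈ T10 M y, γ y w = 0 := by
    filter_upwards [self_mem_nhdsWithin] with y hy using hγ.annihilates y hy
  have hγx : DifferentiableWithinAt ℝ γ M x := hγ.smooth.differentiableOn (by simp) x hx
  rw [CRGeom.extD_comp_projH hP hα hu hv,
    extD_eq_neg_apply_horizontalBracket hx hP hγx hann hu hv, ← hc, map_smul, map_smul,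
    ht.apply_eq_I, Complex.real_smul, Complex.real_smul]
  linear_combination (c : ℂ) * α x t * Complex.I_sq

theorem IsCharacteristicVector.pair11_extD_comp_projH (ht : IsCharacteristicVector M γ x t)
    (hM : IsCRHypersurfaceType M n) (hγ : IsCharacteristicForm M γ) (hx : x ∈ M)
    {α : Cn N → Cn N →L[ℝ] ℂ} (hα : DifferentiableWithinAt ℝ α M x) {ξ ζ : Cn N}
    (hξ : ξ ∈ T10 M x) (hζ : ζ ∈ T10 M x) :
    pair11 (extD M (fun y => α y ∘L projH M y) x) ξ ζ
      = pair11 (extD M α x) ξ ζ + Complex.I * α x t * leviForm M γ x ξ ζ := by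
  have hJξ := J_mem_T10 hξ
  have hJζ := J_mem_T10 hζ
  rw [leviForm, pair11, pair11, pair11, ht.extD_comp_projH hM hγ hx hα hξ hζ,
    ht.extD_comp_projH hM hγ hx hα hξ hJζ, ht.extD_comp_projH hM hγ hx hα hJξ hζ,
    ht.extD_comp_projH hM hγ hx hα hJξ hJζ]
  ring

theorem IsCharacteristicForm.exists_pos_forall_mul_norm_le_norm_apply
    (hγ : IsCharacteristicForm M γ) (hM : IsCRHypersurfaceType M n) (hcpt : IsCompact M) :
    ∃ δ > 0, ∀ x ∈ M, ∀ v ∈ tangentSp M x, projH M x v = 0 → δ * ‖v‖ ≤ ‖γ x v‖ := by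
  set S := {p : Cn N × Cn N | p.1 ∈ M ∧ p.2 ∈ tangentSp M p.1} ∩ M ×ˢ Metric.sphere 0 1
  have hS : IsClosed S := (isClosed_setOf_mem_tangentSp hM.2.1 hcpt.isClosed).inter
    (hcpt.isClosed.prod Metric.isClosed_sphere)
  have hcont {F : Type} [NormedAddCommGroup F] [NormedSpace ℝ F] {α : Cn N → Cn N →L[ℝ] F}
      (hα : ContinuousOn α M) : ContinuousOn (fun p : Cn N × Cn N => α p.1 p.2) S :=
    (hα.comp continuousOn_fst fun p hp => hp.1.1).clm_apply continuousOn_snd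
  set K := S ∩ (fun p : Cn N × Cn N => projH M p.1 p.2) ⁻¹' {0}
  have hK : IsCompact K :=
    (hcpt.prod (isCompact_sphere 0 1)).of_isClosed_subset
      ((hcont hM.differentiableOn_projH.continuousOn).preimage_isClosed_of_isClosed hS
        isClosed_singleton) fun p hp => hp.1.2
  have hpos : ∀ p ∈ K, 0 < ‖γ p.1 p.2‖ := by
    rintro ⟨x, v⟩ ⟨⟨⟨hx, hv⟩, -, hv1⟩, hPv⟩
    obtain ⟨t, ht⟩ := hγ.exists_isCharacteristicVector hx
    obtain ⟨c, rfl⟩ := ht.exists_smul_eq hM hx hv hPv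
    have hc : c ≠ 0 := left_ne_zero_of_smul (ne_zero_of_mem_unit_sphere ⟨c • t, hv1⟩)
    rw [map_smul, ht.apply_eq_I, norm_pos_iff]
    exact smul_ne_zero hc Complex.I_ne_zero
  obtain ⟨δ, hδ, hle⟩ :=
    hK.exists_forall_le' ((hcont hγ.smooth.continuousOn).mono inter_subset_left).norm hpos
  refine ⟨δ, hδ, fun x hx v hv hPv => ?_⟩
  rcases eq_or_ne v 0 with rfl | hv0
  · simp
  have hunit : ‖(‖v‖⁻¹ : ℝ) • v‖ = 1 := by
    rw [norm_smul, norm_inv, norm_norm, inv_mul_cancel₀ (norm_ne_zero_iff.2 hv0)]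
  have h := hle (x, (‖v‖⁻¹ : ℝ) • v) ⟨⟨⟨hx, Submodule.smul_mem _ _ hv⟩, hx, by simpa using hunit⟩,
    by simp [hPv]⟩
  rw [map_smul, norm_smul, norm_inv, norm_norm, le_inv_mul_iff₀' (norm_pos_iff.2 hv0)] at h
  exact h

end CharacteristicVector

theorem J_J (v : Cn N) : J N (J N v) = -v := by
  rw [J_apply, J_apply, smul_smul, Complex.I_mul_I, neg_one_smul]

theorem smul_eq_re_smul_add_im_smul_J (c : ℂ) (v : Cn N) : c • v = c.re • v + c.im • J N v := by
  conv_lhs => rw [← Complex.re_add_im c, add_smul, mul_smul, ← J_apply]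
  simp only [Complex.coe_smul]

/-- The sesquilinear form `(ξ, ζ) ↦ ⟨B, Z_ξ ∧ conj Z_ζ⟩` of a real-bilinear form `B`, so that
`pairSesq (fderiv ℝ (fderiv ℝ f) x)` is the complex Hessian of `f`; unlike in `pair11`, linearity
in each argument is part of the data. -/
def pairSesq (B : Cn N →L[ℝ] Cn N →L[ℝ] ℂ) : Cn N →ₗ[ℂ] Cn N →ₗ⋆[ℂ] ℂ :=
  LinearMap.mk₂'ₛₗ _ _ (pair11 fun u v => B u v)
    (fun a b c => by
      simp only [pair11, map_add, add_apply]
      ring)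
    (fun c a b => by
      simp only [smul_eq_re_smul_add_im_smul_J, pair11, map_add, map_smul, J_J, map_neg, smul_neg,
        add_apply, smul_apply, neg_apply, Complex.real_smul, RingHom.id_apply]
      conv_rhs => rw [smul_eq_mul, ← Complex.re_add_im c]
      linear_combination (c.im / 4 : ℂ) * (B (J N a) b - B a (J N b)) * Complex.I_sq)
    (fun a b c => by
      simp only [pair11, map_add]
      ring)
    (fun c a b => by
      have hc : (starRingEnd ℂ) c = c.re - c.im * Complex.I := by
        apply Complex.ext <;> simp
      simp only [smul_eq_re_smul_add_im_smul_J c b, pair11, map_add, map_smul, J_J, map_neg,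
        smul_neg, Complex.real_smul, smul_eq_mul, hc]
      linear_combination (c.im / 4 : ℂ) * (B a (J N b) - B (J N a) b) * Complex.I_sq)

section SecondOrder

variable {f : Cn N → ℂ} {x : Cn N}

theorem hasFDerivAt_fderiv_comp_J (hf : DifferentiableAt ℝ (fderiv ℝ f) x) :
    HasFDerivAt (fun y => fderiv ℝ f y ∘L J N)
      (((ContinuousLinearMap.compL ℝ (Cn N) (Cn N) ℂ).flip (J N)) ∘L fderiv ℝ (fderiv ℝ f) x) x :=
  ((ContinuousLinearMap.compL ℝ (Cn N) (Cn N) ℂ).flip (J N)).hasFDerivAt.comp x hf.hasFDerivAt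

theorem differentiableAt_delbar (hf : DifferentiableAt ℝ (fderiv ℝ f) x) :
    DifferentiableAt ℝ (delbar f) x :=
  (hf.add ((hasFDerivAt_fderiv_comp_J hf).differentiableAt.const_smul Complex.I)).const_smul
    (1 / 2 : ℂ)

theorem differentiableAt_del (hf : DifferentiableAt ℝ (fderiv ℝ f) x) :
    DifferentiableAt ℝ (del f) x :=
  (hf.sub ((hasFDerivAt_fderiv_comp_J hf).differentiableAt.const_smul Complex.I)).const_smul
    (1 / 2 : ℂ)

theorem fderiv_delbar_apply (hf : DifferentiableAt ℝ (fderiv ℝ f) x) (u v : Cn N) :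
    fderiv ℝ (delbar f) x u v = (1 / 2 : ℂ) *
      (fderiv ℝ (fderiv ℝ f) x u v + Complex.I * fderiv ℝ (fderiv ℝ f) x u (J N v)) := by
  have h : HasFDerivAt (delbar f) _ x :=
    (hf.hasFDerivAt.add ((hasFDerivAt_fderiv_comp_J hf).const_smul Complex.I)).const_smul
      (1 / 2 : ℂ)
  rw [h.fderiv]
  rfl

theorem fderiv_del_apply (hf : DifferentiableAt ℝ (fderiv ℝ f) x) (u v : Cn N) :
    fderiv ℝ (del f) x u v = (1 / 2 : ℂ) *
      (fderiv ℝ (fderiv ℝ f) x u v - Complex.I * fderiv ℝ (fderiv ℝ f) x u (J N v)) := by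
  have h : HasFDerivAt (del f) _ x :=
    (hf.hasFDerivAt.sub ((hasFDerivAt_fderiv_comp_J hf).const_smul Complex.I)).const_smul
      (1 / 2 : ℂ)
  rw [h.fderiv]
  rfl

theorem delbar_apply_sub_del_apply (f : Cn N → ℂ) (x v : Cn N) :
    delbar f x v - del f x v = Complex.I * fderiv ℝ f x (J N v) := by
  simp only [delbar, del, smul_apply, add_apply, sub_apply, smul_eq_mul,
    ContinuousLinearMap.comp_apply]
  ring

theorem complexHessian_apply (hf : DifferentiableAt ℝ (fderiv ℝ f) x) (j k : Fin N) :
    complexHessian f x j k = pairSesq (fderiv ℝ (fderiv ℝ f) x)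
      (EuclideanSpace.single j 1) (EuclideanSpace.single k 1) := by
  set e : Fin N → Cn N := fun j => EuclideanSpace.single j 1
  have hderiv (u : Cn N) :
      fderiv ℝ (fun y => delbar f y (e k)) x u = fderiv ℝ (delbar f) x u (e k) := by
    rw [fderiv_clm_apply (differentiableAt_delbar hf) (differentiableAt_const _)]
    simp
  calc complexHessian f x j k
      = (1 / 2 : ℂ) * (fderiv ℝ (fun y => delbar f y (e k)) x (e j)
          - Complex.I * fderiv ℝ (fun y => delbar f y (e k)) x (J N (e j))) := rfl
    _ = pair11 (fun u v => fderiv ℝ (fderiv ℝ f) x u v) (e j) (e k) := by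
      rw [hderiv, hderiv, fderiv_delbar_apply hf, fderiv_delbar_apply hf, pair11]
      linear_combination
        (-1 / 4 : ℂ) * fderiv ℝ (fderiv ℝ f) x (J N (e j)) (J N (e k)) * Complex.I_sq

theorem extD_eq_of_differentiableAt {M : Set (Cn N)} {α : Cn N → Cn N →L[ℝ] ℂ}
    (hα : DifferentiableAt ℝ α x) {u v : Cn N} (hu : u ∈ tangentSp M x) (hv : v ∈ tangentSp M x) :
    extD M α x u v = fderiv ℝ α x u v - fderiv ℝ α x v u := by
  have heq : EqOn (fderivWithin ℝ α M x) (fderiv ℝ α x) (tangentSp M x) :=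
    eqOn_tangentSp_of_hasFDerivWithinAt hα.differentiableWithinAt.hasFDerivWithinAt
      hα.hasFDerivAt.hasFDerivWithinAt
  rw [extD, heq hu, heq hv]

theorem pair11_extD_delbar {M : Set (Cn N)} (hf : ContDiffAt ℝ 2 f x) {ξ ζ : Cn N}
    (hξ : ξ ∈ T10 M x) (hζ : ζ ∈ T10 M x) :
    pair11 (extD M (delbar f) x) ξ ζ = pairSesq (fderiv ℝ (fderiv ℝ f) x) ξ ζ := by
  have hd : DifferentiableAt ℝ (fderiv ℝ f) x :=
    differentiableAt_fderiv_of_contDiffAt hf le_rfl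
  have hsymm : IsSymmSndFDerivAt ℝ f x := hf.isSymmSndFDerivAt (by simp)
  have hext {u v : Cn N} (hu : u ∈ T10 M x) (hv : v ∈ T10 M x) : extD M (delbar f) x u v
      = Complex.I / 2 * (fderiv ℝ (fderiv ℝ f) x u (J N v)
        - fderiv ℝ (fderiv ℝ f) x v (J N u)) := by
    rw [extD_eq_of_differentiableAt (differentiableAt_delbar hd) hu.1 hv.1,
      fderiv_delbar_apply hd, fderiv_delbar_apply hd, hsymm.eq u v]
    ring
  have hJξ := J_mem_T10 hξ
  have hJζ := J_mem_T10 hζ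
  change _ = pair11 (fun u v => fderiv ℝ (fderiv ℝ f) x u v) ξ ζ
  rw [pair11, pair11, hext hξ hζ, hext hξ hJζ, hext hJξ hζ, hext hJξ hJζ]
  simp only [J_J, map_neg, hsymm.eq ζ ξ, hsymm.eq ζ (J N ξ), hsymm.eq (J N ζ) ξ,
    hsymm.eq (J N ζ) (J N ξ)]
  linear_combination (-1 / 4 : ℂ) * (fderiv ℝ (fderiv ℝ f) x ξ ζ
    + fderiv ℝ (fderiv ℝ f) x (J N ξ) (J N ζ)) * Complex.I_sq

theorem pair11_extD_del {M : Set (Cn N)} (hf : ContDiffAt ℝ 2 f x) {ξ ζ : Cn N}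
    (hξ : ξ ∈ T10 M x) (hζ : ζ ∈ T10 M x) :
    pair11 (extD M (del f) x) ξ ζ = -pairSesq (fderiv ℝ (fderiv ℝ f) x) ξ ζ := by
  have hd : DifferentiableAt ℝ (fderiv ℝ f) x :=
    differentiableAt_fderiv_of_contDiffAt hf le_rfl
  have hsymm : IsSymmSndFDerivAt ℝ f x := hf.isSymmSndFDerivAt (by simp)
  have hneg {u v : Cn N} (hu : u ∈ T10 M x) (hv : v ∈ T10 M x) :
      extD M (del f) x u v = -extD M (delbar f) x u v := by
    rw [extD_eq_of_differentiableAt (differentiableAt_del hd) hu.1 hv.1,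
      extD_eq_of_differentiableAt (differentiableAt_delbar hd) hu.1 hv.1,
      fderiv_delbar_apply hd, fderiv_delbar_apply hd, fderiv_del_apply hd, fderiv_del_apply hd,
      hsymm.eq u v]
    ring
  have hJξ := J_mem_T10 hξ
  have hJζ := J_mem_T10 hζ
  rw [← pair11_extD_delbar hf hξ hζ, pair11, pair11, hneg hξ hζ, hneg hξ hJζ, hneg hJξ hζ,
    hneg hJξ hJζ]
  ring

end SecondOrder

/-- Entrywise complex conjugation. The complex Hessian has rows indexed by `∂/∂z_j` and columns by
`∂/∂z̄_k`, so it acts on the conjugates of the coordinate vectors of `T^{1,0}`. -/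
def conjVec (v : Cn N) : Cn N := WithLp.toLp 2 fun i => (starRingEnd ℂ) (v i)

theorem orthonormal_conjVec {ι : Type*} {Z : ι → Cn N} (hZ : Orthonormal ℂ Z) :
    Orthonormal ℂ fun j => conjVec (Z j) := by
  classical
  have hinner (v w : Cn N) :
      inner ℂ (conjVec v) (conjVec w) = (starRingEnd ℂ) (inner ℂ v w) := by
    simp [PiLp.inner_apply, conjVec]
  rw [orthonormal_iff_ite] at hZ ⊢
  intro i j
  rw [hinner, hZ i j]
  split_ifs <;> simp

theorem pairSesq_self_eq_inner {f : Cn N → ℂ} {x : Cn N}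
    (hf : DifferentiableAt ℝ (fderiv ℝ f) x) (ξ : Cn N) :
    pairSesq (fderiv ℝ (fderiv ℝ f) x) ξ ξ = inner ℂ (conjVec ξ)
      (Matrix.toEuclideanLin (complexHessian f x) (conjVec ξ)) := by
  have hξ : ∑ j, ξ j • (EuclideanSpace.single j 1 : Cn N) = ξ := by
    simpa using (EuclideanSpace.basisFun (Fin N) ℂ).sum_repr ξ
  calc pairSesq (fderiv ℝ (fderiv ℝ f) x) ξ ξ
      = ∑ k, ∑ j, (starRingEnd ℂ) (ξ k) * (ξ j * complexHessian f x j k) := by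
        conv_lhs => rw [← hξ]
        simp only [map_sum, LinearMap.sum_apply, map_smulₛₗ, LinearMap.smul_apply,
          RingHom.id_apply, smul_eq_mul, ← complexHessian_apply hf, Finset.mul_sum]
    _ = inner ℂ (conjVec ξ) (Matrix.toEuclideanLin (complexHessian f x) (conjVec ξ)) := by
        simp only [PiLp.inner_apply, Matrix.toLpLin_apply, conjVec, Matrix.mulVec, dotProduct,
          RCLike.inner_apply, Complex.conj_conj, Finset.sum_mul]
        rw [Finset.sum_comm]
        exact Finset.sum_congr rfl fun j _ => Finset.sum_congr rfl fun k _ => by ring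

section CRHessian

variable {M : Set (Cn N)} {n : ℕ} {γ : Cn N → Cn N →L[ℝ] ℂ}

theorem IsCharacteristicVector.half_delbDelbarb_sub_delbarbDelb {x t : Cn N}
    (ht : IsCharacteristicVector M γ x t) (hM : IsCRHypersurfaceType M n)
    (hγ : IsCharacteristicForm M γ) (hx : x ∈ M) {f : Cn N → ℂ} (hf : ContDiffAt ℝ 2 f x)
    {ξ ζ : Cn N} (hξ : ξ ∈ T10 M x) (hζ : ζ ∈ T10 M x) :
    (1 / 2 : ℂ) * (delbDelbarb M f x ξ ζ - delbarbDelb M f x ξ ζ)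
      = pairSesq (fderiv ℝ (fderiv ℝ f) x) ξ ζ
        - (1 / 2 : ℂ) * fderiv ℝ f x (J N t) * leviForm M γ x ξ ζ := by
  have hd : DifferentiableAt ℝ (fderiv ℝ f) x :=
    differentiableAt_fderiv_of_contDiffAt hf le_rfl
  have hdelbarb : delbDelbarb M f x ξ ζ = pairSesq (fderiv ℝ (fderiv ℝ f) x) ξ ζ
      + Complex.I * delbar f x t * leviForm M γ x ξ ζ := by
    rw [← pair11_extD_delbar hf hξ hζ]
    exact ht.pair11_extD_comp_projH hM hγ hx (differentiableAt_delbar hd).differentiableWithinAt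
      hξ hζ
  have hdelb : delbarbDelb M f x ξ ζ = -pairSesq (fderiv ℝ (fderiv ℝ f) x) ξ ζ
      + Complex.I * del f x t * leviForm M γ x ξ ζ := by
    rw [← pair11_extD_del hf hξ hζ]
    exact ht.pair11_extD_comp_projH hM hγ hx (differentiableAt_del hd).differentiableWithinAt
      hξ hζ
  rw [hdelbarb, hdelb]
  linear_combination (Complex.I / 2) * leviForm M γ x ξ ζ * delbar_apply_sub_del_apply f x t
    + (1 / 2 : ℂ) * fderiv ℝ f x (J N t) * leviForm M γ x ξ ζ * Complex.I_sq

theorem IsCharacteristicForm.exists_forall_norm_apply_J_le {F : Type*} [NormedAddCommGroup F]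
    [NormedSpace ℝ F] (hγ : IsCharacteristicForm M γ) (hM : IsCRHypersurfaceType M n)
    (hcpt : IsCompact M) {β : Cn N → Cn N →L[ℝ] F} (hβ : ContinuousOn β M) :
    ∃ C, ∀ x ∈ M, ∀ t, IsCharacteristicVector M γ x t → ‖β x (J N t)‖ ≤ C := by
  obtain ⟨δ, hδ, hle⟩ := hγ.exists_pos_forall_mul_norm_le_norm_apply hM hcpt
  obtain ⟨C, hC⟩ := hcpt.exists_bound_of_continuousOn hβ
  refine ⟨C * δ⁻¹, fun x hx t ht => ?_⟩
  have ht_norm : ‖J N t‖ ≤ δ⁻¹ := by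
    have h := hle x hx t ht.mem_tangentSp ht.projH_eq_zero
    rw [ht.apply_eq_I, Complex.norm_I] at h
    rw [J_apply, norm_smul, Complex.norm_I, one_mul]
    exact (le_inv_mul_iff₀ hδ).2 h |>.trans_eq (mul_one _)
  exact (β x).le_of_opNorm_le_of_le (hC x hx) ht_norm

theorem exists_pos_forall_re_pairSesq_le (hcpt : IsCompact M) (hM : IsCRHypersurfaceType M n)
    (hγ : IsCharacteristicForm M γ) (hpsc : LeviNonneg M γ) {lam : Cn N → ℝ}
    (hlam : ∀ x ∈ M, ContDiffAt ℝ 2 lam x) :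
    ∃ A₀ : ℝ, 0 < A₀ ∧ ∀ x ∈ M, ∀ ξ ∈ T10 M x,
      (pairSesq (fderiv ℝ (fderiv ℝ fun y => (lam y : ℂ)) x) ξ ξ).re
        ≤ ((1 / 2 : ℂ) * (delbDelbarb M (fun y => (lam y : ℂ)) x ξ ξ
            - delbarbDelb M (fun y => (lam y : ℂ)) x ξ ξ)
          + (A₀ : ℂ) * leviForm M γ x ξ ξ).re := by
  obtain ⟨C, hC⟩ := hγ.exists_forall_norm_apply_J_le hM hcpt (β := fderiv ℝ lam) fun x hx =>
    ((hlam x hx).continuousAt_fderiv two_ne_zero).continuousWithinAt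
  refine ⟨max C 1, by positivity, fun x hx ξ hξ => ?_⟩
  obtain ⟨t, ht⟩ := hγ.exists_isCharacteristicVector hx
  have hf : ContDiffAt ℝ 2 (fun y => (lam y : ℂ)) x :=
    Complex.ofRealCLM.contDiff.contDiffAt.comp x (hlam x hx)
  have hfderiv : fderiv ℝ (fun y => (lam y : ℂ)) x (J N t) = (fderiv ℝ lam x (J N t) : ℝ) :=
    congrArg (· (J N t)) (Complex.ofRealCLM.hasFDerivAt.comp x
      ((hlam x hx).differentiableAt two_ne_zero).hasFDerivAt).fderiv
  have hcoeff : 1 / 2 * fderiv ℝ lam x (J N t) ≤ max C 1 := by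
    have hnorm := (le_abs_self _).trans (hC x hx t ht)
    linarith [le_max_left C 1, le_max_right C 1]
  have hlevi := mul_le_mul_of_nonneg_right hcoeff (hpsc x hx ξ hξ)
  rw [ht.half_delbDelbarb_sub_delbarbDelb hM hγ hx hf hξ hξ, hfderiv,
    show (1 / 2 : ℂ) = (1 / 2 : ℝ) by norm_num, ← Complex.ofReal_mul, Complex.add_re,
    Complex.sub_re, Complex.re_ofReal_mul, Complex.re_ofReal_mul]
  linarith

end CRHessian

end CRGeom
end

theorem mainTheorem5_general {N : ℕ} {n q : ℕ} {M : Set (CRGeom.Cn N)} (hcpt : IsCompact M)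
    (hM : CRGeom.IsCRHypersurfaceType M n) {γ : CRGeom.Cn N → CRGeom.Cn N →L[ℝ] ℂ}
    (hγ : CRGeom.IsCharacteristicForm M γ) (hpsc : CRGeom.LeviNonneg M γ)
    {lam : CRGeom.Cn N → ℝ} {A : ℝ} (hlam : ∀ x ∈ M, ContDiffAt ℝ 2 lam x)
    (hA : ∀ x ∈ M, ∃ h : (CRGeom.complexHessian (fun y => (lam y : ℂ)) x).IsHermitian,
      ∀ s : Finset (Fin N), s.card = q → A ≤ ∑ i ∈ s, h.eigenvalues i) :
    CRGeom.CRPshBound M γ q lam A := by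
  obtain ⟨A₀, hA₀, hle⟩ := CRGeom.exists_pos_forall_re_pairSesq_le hcpt hM hγ hpsc hlam
  refine ⟨A₀, hA₀, fun x hx Z hZ hZo => ?_⟩
  obtain ⟨hHerm, hsum⟩ := hA x hx
  have hd : DifferentiableAt ℝ (fderiv ℝ fun y => (lam y : ℂ)) x :=
    CRGeom.differentiableAt_fderiv_of_contDiffAt
      (Complex.ofRealCLM.contDiff.contDiffAt.comp x (hlam x hx)) le_rfl
  calc A ≤ ∑ j, RCLike.re (inner ℂ (CRGeom.conjVec (Z j)) (Matrix.toEuclideanLin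
          (CRGeom.complexHessian (fun y => (lam y : ℂ)) x) (CRGeom.conjVec (Z j)))) :=
        CRGeom.le_sum_re_inner_toEuclideanLin hHerm (by simpa only [Fintype.card_fin] using hsum)
          (CRGeom.orthonormal_conjVec hZo)
    _ ≤ _ := by
        rw [Complex.re_sum]
        refine Finset.sum_le_sum fun j _ => ?_
        rw [← CRGeom.pairSesq_self_eq_inner hd]
        exact hle x hx (Z j) (hZ j)

theorem mainTheorem5 {N : ℕ} (n q : ℕ) (M : Set (CRGeom.Cn N)) (hcpt : IsCompact M)
    (hM : CRGeom.IsCRHypersurfaceType M n)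
    (γ : CRGeom.Cn N → CRGeom.Cn N →L[ℝ] ℂ) (hγ : CRGeom.IsCharacteristicForm M γ)
    (hpsc : CRGeom.LeviNonneg M γ)
    (lam : CRGeom.Cn N → ℝ) (A : ℝ) (U : Set (CRGeom.Cn N)) (hU : IsOpen U) (hMU : M ⊆ U)
    (hlam : CRGeom.IsPshOnForms q lam U A) :
    CRGeom.IsWeaklyCRPsh M γ q lam A ∧ (0 < A → CRGeom.IsStrictlyCRPsh M γ q lam A) := by
  have hbound := mainTheorem5_general hcpt hM hγ hpsc
    (fun x hx => (hlam.1.contDiffAt (hU.mem_nhds (hMU hx))).of_le (by norm_cast))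
    fun x hx => hlam.2.2 x (hMU hx)
  exact ⟨⟨⟨U, hU, hMU, hlam.1⟩, hlam.2.1, hbound⟩, fun hA => ⟨⟨U, hU, hMU, hlam.1⟩, hA, hbound⟩⟩
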